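/- Let $M$ be a matroid on a finite ground set $E$, let $m, \Delta \ge 0$ be integers, and let $W(e) \in \{-\Delta,\dots,\Delta\}^m$ be an integer weight vector for each $e \in E$. For $S \subseteq E$ write $W(S) = \sum_{e \in S} W(e) \in \mathbb{Z}^m$, and write $X \oplus Y = (X \setminus Y) \cup (Y \setminus X)$ for the symmetric difference. Let $A, B$ be bases of $M$. Then there exists a basis $A'$ of $M$ with $W(A') = W(A)$ and $$|A' \oplus B| \le (2m\Delta)^{12m} \cdot \|W(B) - W(A)\|_1,$$ where $0^0 = 1$. In particular, the bound does not depend on the number of elements of $E$. -/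

import Mathlib

/-- The total weight `W(S) = ∑_{e ∈ S} W(e) ∈ ℤ^m` of a finite set `S` of elements. -/
def setWeight {α : Type*} {m : ℕ} (W : α → Fin m → ℤ) (S : Finset α) : Fin m → ℤ :=
  ∑ e ∈ S, W e

/-- The `ℓ₁`-norm of an integer vector. -/
def l1Norm {m : ℕ} (v : Fin m → ℤ) : ℤ :=
  ∑ i, |v i|

/-!
Let `C = (4mΔ + 1)^m`. Call the set of elements of `A \ B` (or of `B \ A`) of a given weight a block,
and call a block `A_p` of `A \ B` and a block `B_q` of `B \ A` linked if `B_q` has rank at least `C`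
after contracting `A \ A_p`.

* Up to `C` exchanges between linked blocks, starting from `A`, can be made one after the other,
  since an exchange lowers the relevant ranks by at most one (`exists_simultaneous_exchange`). Only
  the blocks of the exchanged elements are prescribed, but they determine the change of weight.
* There are at most `τ = (2Δ + 1)^m` blocks on each side, and the rank of `B \ A` over the rest is
  subadditive over pairs of blocks. Hence, by the deficiency version of Hall's theorem, `B \ A` can
  be matched with `A \ B` so that all but `τ² (C - 1)` pairs lie in linked blocks
  (`exists_equiv_linked`).
* The weight differences of the matched pairs add up to `W(B) - W(A)`. Adding
  `‖W(B) - W(A)‖₁` unit vectors gives a zero-sum family of vectors in `{-2Δ, …, 2Δ}^m`. By the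
  Steinitz lemma zero-sum families split into zero-sum parts with at most `C` members, so if
  `|A \ B|` is large, one part avoids both the unit vectors and the unlinked pairs
  (`exists_small_zero_sum_avoiding`).

Carrying out the exchanges of this part keeps the weight and brings `A` closer to `B`
(`exists_closer_basis`). When this is no longer possible, `|A \ B|` is at most
`C (τ² (C - 1) + ‖W(B) - W(A)‖₁)`, which is well within the claimed bound.
-/

/-! ### Zero-sum subfamilies of bounded integer vectors -/

section ZeroSum

variable {ι : Type*} {m : ℕ}

/-- A nonempty compact polytope cut out of the unit cube by `n` linear equations has a point with
at most `n` coordinates strictly between `0` and `1`. -/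
lemma exists_few_fractional [Fintype ι] {V : Type*} [NormedAddCommGroup V] [NormedSpace ℝ V]
    [FiniteDimensional ℝ V] (u : ι → V) (w : V) (l₀ : ι → ℝ)
    (h₀ : ∀ x, 0 ≤ l₀ x ∧ l₀ x ≤ 1) (hw : ∑ x, l₀ x • u x = w) :
    ∃ l : ι → ℝ, (∀ x, 0 ≤ l x ∧ l x ≤ 1) ∧ ∑ x, l x • u x = w ∧
      (Finset.univ.filter fun x => 0 < l x ∧ l x < 1).card ≤ Module.finrank ℝ V := by
  classical
  set K : Set (ι → ℝ) := Set.Icc 0 1 ∩ {l | ∑ x, l x • u x = w} with hK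
  have hcomp : IsCompact K := by
    refine isCompact_Icc.inter_right (isClosed_eq ?_ continuous_const)
    fun_prop
  have hne : K.Nonempty := ⟨l₀, ⟨fun x => (h₀ x).1, fun x => (h₀ x).2⟩, hw⟩
  obtain ⟨l, hl⟩ := hcomp.extremePoints_nonempty hne
  have hlK : l ∈ K := hl.1
  refine ⟨l, fun x => ⟨hlK.1.1 x, hlK.1.2 x⟩, hlK.2, ?_⟩
  by_contra! hcard
  set F := Finset.univ.filter fun x => 0 < l x ∧ l x < 1 with hF
  have hdep : ¬ LinearIndependent ℝ (fun x : F => u x) := by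
    intro hli
    have := hli.fintype_card_le_finrank
    rw [Fintype.card_coe] at this
    omega
  obtain ⟨g, hg, x₀, hx₀⟩ := Fintype.not_linearIndependent_iff.mp hdep
  -- extend the relation by zero
  let c : ι → ℝ := fun x => if h : x ∈ F then g ⟨x, h⟩ else 0
  have hcF : ∀ x : F, c x = g x := fun x => by simp [c]
  have hc0 : ∀ x, x ∉ F → c x = 0 := fun x h => by simp [c, h]
  have hcsum : ∑ x, c x • u x = 0 := by
    rw [← Finset.sum_subset (Finset.subset_univ F), ← Finset.sum_coe_sort F]
    · simpa [hcF] using hg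
    · intro x _ hx
      simp [hc0 x hx]
  -- a step length that keeps every coordinate inside the unit interval
  obtain ⟨ε, hε, hstep⟩ : ∃ ε > 0, ∀ x, |ε * c x| ≤ l x ∧ |ε * c x| ≤ 1 - l x := by
    have hev : ∀ x, ∀ᶠ ε in nhdsWithin (0 : ℝ) (Set.Ioi 0),
        |ε * c x| ≤ l x ∧ |ε * c x| ≤ 1 - l x := by
      intro x
      by_cases hx : x ∈ F
      · have hx' := (Finset.mem_filter.mp hx).2
        have ht : Filter.Tendsto (fun ε : ℝ => |ε * c x|) (nhdsWithin 0 (Set.Ioi 0)) (nhds 0) := by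
          have : Continuous fun ε : ℝ => |ε * c x| := by fun_prop
          simpa using (this.tendsto 0).mono_left nhdsWithin_le_nhds
        filter_upwards [ht.eventually_le_const hx'.1,
          ht.eventually_le_const (sub_pos.mpr hx'.2)] with ε h1 h2
        exact ⟨h1, h2⟩
      · refine Filter.Eventually.of_forall fun ε => ?_
        have h1 := hlK.1.1 x
        have h2 := hlK.1.2 x
        simp only [Pi.zero_apply, Pi.one_apply] at h1 h2
        simp [hc0 x hx, h1, h2]
    obtain ⟨ε, h1, h2⟩ := ((Filter.eventually_all.mpr hev).and self_mem_nhdsWithin).exists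
    exact ⟨ε, h2, h1⟩
  have hmem : ∀ s : ℝ, |s| = ε → l + s • c ∈ K := by
    intro s hs
    have habs : ∀ x, |s * c x| = |ε * c x| := fun x => by
      rw [abs_mul, abs_mul, hs, abs_of_pos hε]
    refine ⟨⟨fun x => ?_, fun x => ?_⟩, ?_⟩
    · have := (hstep x).1
      rw [← habs] at this
      have := (abs_le.mp this).1
      simp; linarith
    · have := (hstep x).2
      rw [← habs] at this
      have := (abs_le.mp this).2
      simp; linarith
    · have h1 : ∑ x, l x • u x = w := hlK.2
      have : ∑ x, (l + s • c) x • u x = ∑ x, l x • u x + s • ∑ x, c x • u x := by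
        simp [add_smul, Finset.sum_add_distrib, Finset.smul_sum, mul_smul]
      simp only [Set.mem_ofPred_eq, this, h1, hcsum, smul_zero, add_zero]
  have hp := hmem ε (abs_of_pos hε)
  have hn := hmem (-ε) (by rw [abs_neg, abs_of_pos hε])
  have hseg : l ∈ openSegment ℝ (l + ε • c) (l + (-ε) • c) := by
    refine ⟨1 / 2, 1 / 2, by norm_num, by norm_num, by norm_num, ?_⟩
    ext x
    simp
    ring
  have heq := (mem_extremePoints.mp hl).2 _ hp _ hn hseg
  have := congrFun heq.1 x₀
  simp [hcF, hx₀, hε.ne'] at this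

/-- The invariant of the Steinitz rearrangement: the vectors indexed by `S` admit coefficients
in `[0, 1]` of total mass `|S| - m` whose weighted sum vanishes; nothing is asked once `|S| ≤ m`. -/
def SteinitzGood (v : ι → Fin m → ℤ) (S : Finset ι) : Prop :=
  S.card ≤ m ∨ ∃ l : ι → ℝ, (∀ x ∈ S, 0 ≤ l x ∧ l x ≤ 1) ∧ ∑ x ∈ S, l x = (S.card : ℝ) - m ∧
    ∀ i, ∑ x ∈ S, l x * (v x i : ℝ) = 0

/-- Since the missing mass `∑ (1 - l x)` is `m`, a good subfamily has a small sum. -/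
lemma SteinitzGood.abs_sum_le {v : ι → Fin m → ℤ} {D : ℕ} {S : Finset ι} (h : SteinitzGood v S)
    (hv : ∀ x ∈ S, ∀ i, |v x i| ≤ D) (i : Fin m) : |∑ x ∈ S, v x i| ≤ (m : ℤ) * D := by
  rcases h with h | ⟨l, hl, hsum, hzero⟩
  · calc |∑ x ∈ S, v x i| ≤ ∑ x ∈ S, |v x i| := Finset.abs_sum_le_sum_abs _ _
      _ ≤ ∑ x ∈ S, (D : ℤ) := Finset.sum_le_sum fun x hx => hv x hx i
      _ = S.card * D := by simp
      _ ≤ m * D := by gcongr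
  · have key : |∑ x ∈ S, (v x i : ℝ)| ≤ m * D := by
      have h1 : ∑ x ∈ S, (v x i : ℝ) = ∑ x ∈ S, (1 - l x) * (v x i : ℝ) := by
        simp [sub_mul, Finset.sum_sub_distrib, hzero]
      rw [h1]
      calc |∑ x ∈ S, (1 - l x) * (v x i : ℝ)| ≤ ∑ x ∈ S, |(1 - l x) * (v x i : ℝ)| :=
            Finset.abs_sum_le_sum_abs _ _
        _ ≤ ∑ x ∈ S, (1 - l x) * D := by
            refine Finset.sum_le_sum fun x hx => ?_
            have h0 : 0 ≤ 1 - l x := sub_nonneg.mpr (hl x hx).2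
            rw [abs_mul, abs_of_nonneg h0]
            refine mul_le_mul_of_nonneg_left ?_ h0
            exact_mod_cast hv x hx i
        _ = m * D := by
            rw [← Finset.sum_mul, Finset.sum_sub_distrib, hsum]
            simp
    exact_mod_cast key

lemma SteinitzGood.exists_erase [DecidableEq ι] {v : ι → Fin m → ℤ} {S : Finset ι}
    (h : SteinitzGood v S) (hS : S.Nonempty) : ∃ x ∈ S, SteinitzGood v (S.erase x) := by
  by_cases hSm : S.card ≤ m + 1
  · obtain ⟨x, hx⟩ := hS
    refine ⟨x, hx, Or.inl ?_⟩
    rw [Finset.card_erase_of_mem hx]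
    omega
  rcases h with h | ⟨l, hl, hsum, hzero⟩
  · omega
  push Not at hSm
  have hSm' : (m : ℝ) + 1 < S.card := by exact_mod_cast hSm
  -- scale the coefficients to total mass `|S| - 1 - m`, then pass to a vertex
  set t : ℝ := ((S.card : ℝ) - 1 - m) / (S.card - m) with ht
  have ht0 : 0 ≤ t := div_nonneg (by linarith) (by linarith)
  have ht1 : t ≤ 1 := by rw [ht, div_le_one (by linarith)]; linarith
  let u : S → ℝ × (Fin m → ℝ) := fun x => (1, fun i => (v x i : ℝ))
  obtain ⟨l', hl', hw', hF⟩ := exists_few_fractional u ((S.card : ℝ) - 1 - m, 0)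
    (fun x => t * l x)
    (fun x => ⟨mul_nonneg ht0 (hl x x.2).1, mul_le_one₀ ht1 (hl x x.2).1 (hl x x.2).2⟩) (by
      ext i
      · simp only [u, Prod.fst_sum, Prod.smul_fst, smul_eq_mul, mul_one]
        rw [Finset.sum_coe_sort S fun x => t * l x, ← Finset.mul_sum, hsum, ht]
        field_simp [show (S.card : ℝ) - m ≠ 0 by linarith]
      · simp only [u, Prod.snd_sum, Prod.smul_snd, Finset.sum_apply, Pi.smul_apply, smul_eq_mul,
          Pi.zero_apply]
        rw [Finset.sum_coe_sort S fun x => t * l x * (v x i : ℝ)]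
        simp_rw [mul_assoc]
        rw [← Finset.mul_sum, hzero, mul_zero])
  have hsum' : ∑ x, l' x = (S.card : ℝ) - 1 - m := by
    have := congrArg Prod.fst hw'
    simpa [u, Prod.fst_sum] using this
  have hzero' : ∀ i, ∑ x, l' x * (v x i : ℝ) = 0 := by
    intro i
    have := congrFun (congrArg Prod.snd hw') i
    simpa [u, Prod.snd_sum] using this
  have hrank : Module.finrank ℝ (ℝ × (Fin m → ℝ)) = m + 1 := by
    simp [Module.finrank_prod, add_comm]
  rw [hrank] at hF
  -- a vertex without zero coordinate would have too much mass
  obtain ⟨x₀, hx₀⟩ : ∃ x, l' x = 0 := by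
    by_contra! hne
    set F := Finset.univ.filter fun x => 0 < l' x ∧ l' x < 1 with hFdef
    have hpos : ∀ x, 0 < l' x := fun x => lt_of_le_of_ne (hl' x).1 (hne x).symm
    have hmass : ∑ x, (1 - l' x) = m + 1 := by
      rw [Finset.sum_sub_distrib, hsum']
      simp
      ring
    have hsub : ∑ x ∈ F, (1 - l' x) = m + 1 := by
      rw [← hmass]
      refine Finset.sum_subset (Finset.subset_univ _) fun x _ hx => ?_
      have : ¬ l' x < 1 := fun h => hx (by simp [hFdef, hpos x, h])
      linarith [(hl' x).2]
    have hFne : F.Nonempty := by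
      rw [Finset.nonempty_iff_ne_empty]
      intro h
      rw [h, Finset.sum_empty] at hsub
      linarith [(Nat.cast_nonneg m : (0 : ℝ) ≤ m)]
    have hlt : ∑ x ∈ F, (1 - l' x) < ∑ x ∈ F, (1 : ℝ) :=
      Finset.sum_lt_sum_of_nonempty hFne fun x _ => by linarith [hpos x]
    have : (F.card : ℝ) ≤ m + 1 := by exact_mod_cast hF
    rw [hsub] at hlt
    simp at hlt
    linarith
  refine ⟨x₀, x₀.2, Or.inr ⟨fun x => if h : x ∈ S then l' ⟨x, h⟩ else 0, ?_, ?_, ?_⟩⟩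
  · intro x hx
    simpa [Finset.mem_of_mem_erase hx] using hl' ⟨x, Finset.mem_of_mem_erase hx⟩
  · rw [Finset.card_erase_of_mem x₀.2, Nat.cast_sub (Finset.card_pos.mpr hS), Nat.cast_one,
      ← hsum', Finset.sum_erase _ (by simp [hx₀]), ← Finset.sum_coe_sort S]
    simp
  · intro i
    rw [← hzero' i, Finset.sum_erase _ (by simp [hx₀]), ← Finset.sum_coe_sort S]
    simp

/-- A consequence of the Steinitz lemma: a nonempty zero-sum family of vectors in
`{-D, …, D}^m` has a nonempty zero-sum subfamily of at most `(2mD + 1)^m` members. -/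
lemma exists_small_zero_sum [DecidableEq ι] (v : ι → Fin m → ℤ) (D : ℕ) (I : Finset ι)
    (hI : I.Nonempty) (hv : ∀ x ∈ I, ∀ i, |v x i| ≤ D) (hsum : ∑ x ∈ I, v x = 0) :
    ∃ J ⊆ I, J.Nonempty ∧ J.card ≤ (2 * (m * D) + 1) ^ m ∧ ∑ x ∈ J, v x = 0 := by
  set C := (2 * (m * D) + 1) ^ m with hC
  by_cases hIC : I.card ≤ C
  · exact ⟨I, subset_rfl, hI, hIC, hsum⟩
  push Not at hIC
  have hgood : SteinitzGood v I := by
    by_cases h : I.card ≤ m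
    · exact Or.inl h
    push Not at h
    have hpos : (0 : ℝ) < I.card := by exact_mod_cast (Nat.zero_le _).trans_lt h
    have hm : (m : ℝ) ≤ I.card := by exact_mod_cast h.le
    refine Or.inr ⟨fun _ => ((I.card : ℝ) - m) / I.card, fun _ _ => ⟨?_, ?_⟩, ?_, fun i => ?_⟩
    · exact div_nonneg (by linarith) hpos.le
    · rw [div_le_one hpos]
      linarith [(Nat.cast_nonneg m : (0 : ℝ) ≤ m)]
    · simp [mul_div_cancel₀ _ hpos.ne']
    · have := congrFun hsum i
      rw [Finset.sum_apply, Pi.zero_apply] at this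
      rw [← Finset.mul_sum, ← Int.cast_sum, this]
      simp
  -- a chain of good subfamilies, losing one member at each step
  have hchain : ∀ k, k ≤ I.card → ∃ s : ℕ → Finset ι, s 0 = I ∧
      (∀ j ≤ k, SteinitzGood v (s j) ∧ (s j).card = I.card - j ∧ s j ⊆ I) ∧
      ∀ i j, i ≤ j → j ≤ k → s j ⊆ s i := by
    intro k
    induction k with
    | zero =>
      intro _
      refine ⟨fun _ => I, rfl, fun j hj => ?_, fun _ _ _ _ => subset_rfl⟩
      obtain rfl : j = 0 := by omega
      exact ⟨hgood, by simp, subset_rfl⟩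
    | succ k ih =>
      intro hk
      obtain ⟨s, hs0, hs, hmono⟩ := ih (by omega)
      obtain ⟨hg, hc, hsI⟩ := hs k le_rfl
      obtain ⟨x, hx, hx'⟩ := hg.exists_erase (Finset.card_pos.mp (by omega))
      refine ⟨fun j => if j ≤ k then s j else (s k).erase x, by simp [hs0], fun j hj => ?_,
        fun i j hij hj => ?_⟩
      · by_cases h : j ≤ k
        · simpa [h] using hs j h
        · obtain rfl : j = k + 1 := by omega
          simp only [h, if_false]
          refine ⟨hx', ?_, (Finset.erase_subset _ _).trans hsI⟩
          rw [Finset.card_erase_of_mem hx]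
          omega
      · by_cases h : j ≤ k
        · simpa [h, hij.trans h] using hmono i j hij h
        · by_cases hi : i ≤ k
          · simpa [h, hi] using (Finset.erase_subset _ _).trans (hmono i k hi le_rfl)
          · simp [h, hi]
  obtain ⟨s, -, hs, hmono⟩ := hchain C hIC.le
  -- the `C + 1` partial sums lie in a box with `C` points
  set box : Finset (Fin m → ℤ) :=
    Fintype.piFinset fun _ => Finset.Icc (-((m : ℤ) * D)) ((m : ℤ) * D) with hbox
  have hboxcard : box.card = C := by
    rw [hbox, Fintype.card_piFinset]
    simp only [Int.card_Icc, Finset.prod_const, Finset.card_univ, Fintype.card_fin, hC]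
    congr 1
    rw [show (m : ℤ) * D + 1 - -((m : ℤ) * D) = ((2 * (m * D) + 1 : ℕ) : ℤ) by push_cast; ring,
      Int.toNat_natCast]
  obtain ⟨p, hp, q, hq, hpq, heq⟩ := Finset.exists_ne_map_eq_of_card_lt_of_maps_to
    (s := Finset.range (C + 1)) (t := box) (f := fun j => ∑ x ∈ s j, v x) (by simp [hboxcard])
    (by
      intro j hj
      have hj' : j ≤ C := by simpa [Nat.lt_succ_iff] using hj
      obtain ⟨hg, -, hsub⟩ := hs j hj'
      simp only [hbox, Finset.mem_coe, Fintype.mem_piFinset, Finset.mem_Icc]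
      intro i
      rw [Finset.sum_apply]
      exact abs_le.mp (hg.abs_sum_le (fun x hx => hv x (hsub hx)) i))
  wlog hlt : p < q generalizing p q
  · exact this q hq p hp hpq.symm heq.symm (lt_of_le_of_ne (not_lt.mp hlt) hpq.symm)
  simp only [Finset.mem_range, Nat.lt_succ_iff] at hp hq
  have hsub := hmono p q hlt.le hq
  have hcp := (hs p hp).2.1
  have hcq := (hs q hq).2.1
  have hcard : (s p \ s q).card = q - p := by
    rw [Finset.card_sdiff_of_subset hsub]
    omega
  refine ⟨s p \ s q, Finset.sdiff_subset.trans (hs p hp).2.2, Finset.card_pos.mp (by omega),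
    by omega, ?_⟩
  have := Finset.sum_sdiff (f := v) hsub
  rw [heq] at this
  simpa using this

/-- If a zero-sum family is more than `(2mD + 1)^m` times as large as its set `E` of exceptional
indices, then it has a short nonempty zero-sum subfamily avoiding `E`: split off short zero-sum
subfamilies as long as they meet `E`. -/
lemma exists_small_zero_sum_avoiding [DecidableEq ι] (v : ι → Fin m → ℤ) (D : ℕ) (I E : Finset ι)
    (hv : ∀ x ∈ I, ∀ i, |v x i| ≤ D) (hsum : ∑ x ∈ I, v x = 0)
    (hcard : (2 * (m * D) + 1) ^ m * (I ∩ E).card < I.card) :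
    ∃ J ⊆ I, Disjoint J E ∧ J.Nonempty ∧ J.card ≤ (2 * (m * D) + 1) ^ m ∧
      ∑ x ∈ J, v x = 0 := by
  induction I using Finset.strongInduction with
  | H I ih =>
    obtain ⟨J, hJI, hJne, hJC, hJ0⟩ := exists_small_zero_sum v D I
      (Finset.card_pos.mp (by omega)) hv hsum
    by_cases hJE : Disjoint J E
    · exact ⟨J, hJI, hJE, hJne, hJC, hJ0⟩
    have hlt : ((I \ J) ∩ E).card < (I ∩ E).card := by
      obtain ⟨x, hxJ, hxE⟩ := Finset.not_disjoint_iff.mp hJE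
      refine Finset.card_lt_card (Finset.ssubset_iff_of_subset ?_ |>.mpr ⟨x, ?_, ?_⟩)
      · exact Finset.inter_subset_inter_right Finset.sdiff_subset
      · simp [hJI hxJ, hxE]
      · simp [hxJ]
    obtain ⟨J', hJ'I, h⟩ := ih (I \ J) (Finset.sdiff_ssubset hJI hJne)
      (fun x hx => hv x (Finset.sdiff_subset hx))
      (by
        have := Finset.sum_sdiff (f := v) hJI
        rw [hJ0, add_zero, hsum] at this
        exact this)
      (by
        rw [Finset.card_sdiff_of_subset hJI]
        have h1 : (2 * (m * D) + 1) ^ m * (((I \ J) ∩ E).card + 1) ≤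
            (2 * (m * D) + 1) ^ m * (I ∩ E).card := Nat.mul_le_mul_left _ hlt
        rw [mul_add, mul_one] at h1
        omega)
    exact ⟨J', hJ'I.trans Finset.sdiff_subset, h⟩

end ZeroSum

/-! ### Exchanges between blocks of a matroid -/

section Exchange

variable {α : Type*} {M : Matroid α}

/-- The rank of a finite set in a matroid, as a natural number (it is never infinite). -/
noncomputable def finRk (M : Matroid α) (X : Finset α) : ℕ := (M.eRk X).toNat

lemma coe_finRk (X : Finset α) : (finRk M X : ℕ∞) = M.eRk X := by
  refine ENat.natCast_toNat (ne_top_of_le_ne_top ?_ (M.eRk_le_encard X))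
  simp

lemma finRk_mono {X Y : Finset α} (h : X ⊆ Y) : finRk M X ≤ finRk M Y := by
  have : (finRk M X : ℕ∞) ≤ finRk M Y := by
    rw [coe_finRk, coe_finRk]
    exact M.eRk_mono (by exact_mod_cast h)
  exact_mod_cast this

lemma finRk_of_indep {X : Finset α} (h : M.Indep (X : Set α)) : finRk M X = X.card := by
  have : (finRk M X : ℕ∞) = X.card := by
    rw [coe_finRk, h.eRk_eq_encard, Set.encard_coe_eq_coe_finsetCard]
  exact_mod_cast this

lemma finRk_le_card_of_isBase {A : Finset α} (hA : M.IsBase (A : Set α)) (X : Finset α) :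
    finRk M X ≤ A.card := by
  have : (finRk M X : ℕ∞) ≤ A.card := by
    rw [coe_finRk, ← Set.encard_coe_eq_coe_finsetCard, hA.encard_eq_eRank]
    exact M.eRk_le_eRank _
  exact_mod_cast this

variable [DecidableEq α]

lemma finRk_inter_add_finRk_union_le (X Y : Finset α) :
    finRk M (X ∩ Y) + finRk M (X ∪ Y) ≤ finRk M X + finRk M Y := by
  have : ((finRk M (X ∩ Y) + finRk M (X ∪ Y) : ℕ) : ℕ∞) ≤ (finRk M X + finRk M Y : ℕ) := by
    push_cast
    simp only [coe_finRk, Finset.coe_inter, Finset.coe_union]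
    exact M.eRk_inter_add_eRk_union_le X Y
  exact_mod_cast this

lemma finRk_union_le_add_card (X Y : Finset α) :
    finRk M (X ∪ Y) ≤ finRk M X + Y.card := by
  have : (finRk M (X ∪ Y) : ℕ∞) ≤ (finRk M X + Y.card : ℕ) := by
    push_cast
    rw [coe_finRk, coe_finRk, Finset.coe_union, ← Set.encard_coe_eq_coe_finsetCard]
    exact M.eRk_union_le_eRk_add_encard X Y
  exact_mod_cast this

/-- If `Y` has positive rank after contracting `A \ X`, then some element of `X` can be exchanged
for some element of `Y`. -/
lemma exists_exchange {A X Y : Finset α} (hA : M.IsBase (A : Set α)) (hXY : Disjoint X Y)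
    (h : (A \ X).card < finRk M (A \ X ∪ Y)) :
    ∃ a ∈ X, ∃ b ∈ Y, b ∉ A ∧ M.IsBase (insert b (A.erase a) : Finset α) := by
  have hind : M.Indep ((A \ X : Finset α) : Set α) :=
    hA.indep.subset (by exact_mod_cast Finset.sdiff_subset)
  rw [← finRk_of_indep hind] at h
  have hlt : M.eRk ((A \ X : Finset α) : Set α) < M.eRk ((A \ X ∪ Y : Finset α) : Set α) := by
    rw [← coe_finRk, ← coe_finRk]
    exact_mod_cast h
  obtain ⟨b, hb, hbrk⟩ := M.exists_eRk_insert_eq_add_one_of_lt hlt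
  have hb' : b ∈ Y ∧ b ∉ A \ X := by
    have h1 := hb.1
    have h2 := hb.2
    simp only [Finset.coe_union, Set.mem_union, Finset.mem_coe] at h1 h2
    tauto
  have hbX : b ∉ X := fun hX => Finset.disjoint_left.mp hXY hX hb'.1
  have hbA : b ∉ A := fun h => hb'.2 (Finset.mem_sdiff.mpr ⟨h, hbX⟩)
  have hindb : M.Indep ((insert b (A \ X) : Finset α) : Set α) := by
    rw [Matroid.indep_iff_eRk_eq_encard_of_finite (Finset.finite_toSet _), Finset.coe_insert, hbrk,
      hind.eRk_eq_encard, Set.encard_insert_of_notMem hb.2]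
  obtain ⟨B, hB, hIB, hBI⟩ := hindb.exists_isBase_subset_union_isBase hA
  have hBfin : B.Finite := (Set.toFinite (((insert b (A \ X) : Finset α) : Set α) ∪ A)).subset hBI
  lift B to Finset α using hBfin
  have hIB' : insert b (A \ X) ⊆ B := by exact_mod_cast hIB
  have hBI' : B ⊆ insert b A := by
    have : B ⊆ insert b (A \ X) ∪ A := by exact_mod_cast hBI
    refine this.trans fun x hx => ?_
    simp only [Finset.mem_union, Finset.mem_insert, Finset.mem_sdiff] at hx ⊢
    tauto
  have hcard : B.card = A.card := by
    have := hB.encard_eq_encard_of_isBase hA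
    simp only [Set.encard_coe_eq_coe_finsetCard] at this
    exact_mod_cast this
  have hcardI : (insert b A).card = A.card + 1 := Finset.card_insert_of_notMem hbA
  obtain ⟨a, ha, haB⟩ := Finset.exists_mem_notMem_of_card_lt_card (s := B) (t := insert b A)
    (by omega)
  have hab : a ≠ b := by
    rintro rfl
    exact haB (hIB' (Finset.mem_insert_self _ _))
  have haA : a ∈ A := (Finset.mem_insert.mp ha).resolve_left hab
  have haX : a ∈ X := by
    by_contra haX
    exact haB (hIB' (Finset.mem_insert_of_mem (Finset.mem_sdiff.mpr ⟨haA, haX⟩)))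
  have hBeq : B = insert b (A.erase a) := by
    rw [← Finset.erase_insert_of_ne hab.symm]
    refine Finset.eq_of_subset_of_card_le (Finset.subset_erase.mpr ⟨hBI', haB⟩) ?_
    rw [Finset.card_erase_of_mem ha]
    omega
  exact ⟨a, haX, b, hb'.1, hbA, hBeq ▸ hB⟩

variable {V : Type*} [DecidableEq V]

/-- The block of label `p` of `X` and the block of label `q` of `Y` are `C`-linked with respect to
the basis `A`: the latter has rank at least `C` after contracting the part of `A` outside the
former. For a represented matroid this says that the corresponding submatrix, with `A` as the
coordinate basis, has rank at least `C`. -/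
def Linked (M : Matroid α) (A X Y : Finset α) (W : α → V) (C : ℕ) (p q : V) : Prop :=
  (A \ X.filter (W · = p)).card + C ≤
    finRk M (A \ X.filter (W · = p) ∪ Y.filter (W · = q))

/-- Up to `C` exchanges between `C`-linked blocks can be carried out simultaneously: every exchange
made lowers the rank of any other block by at most one, so the next one is still possible. -/
lemma exists_simultaneous_exchange [AddCommGroup V] {A X Y : Finset α} {W : α → V} {C : ℕ}
    (hA : M.IsBase (A : Set α)) (hXA : X ⊆ A) (hAY : Disjoint A Y) {ι : Type*} [DecidableEq ι]
    (J : Finset ι) (f g : ι → V) (hJ : J.card ≤ C)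
    (hlink : ∀ x ∈ J, Linked M A X Y W C (f x) (g x)) :
    ∃ R ⊆ X, ∃ Q ⊆ Y, R.card = J.card ∧ Q.card = J.card ∧
      M.IsBase ((A \ R ∪ Q : Finset α) : Set α) ∧
      ∑ b ∈ Q, W b - ∑ a ∈ R, W a = ∑ x ∈ J, (g x - f x) := by
  induction J using Finset.induction_on with
  | empty => exact ⟨∅, by simp, ∅, by simp, by simp, by simp, by simpa using hA, by simp⟩
  | insert x J hx ih =>
    rw [Finset.card_insert_of_notMem hx] at hJ
    obtain ⟨R, hRX, Q, hQY, hR, hQ, hbase, hsum⟩ :=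
      ih (by omega) fun y hy => hlink y (Finset.mem_insert_of_mem hy)
    have hl := hlink x (Finset.mem_insert_self _ _)
    unfold Linked at hl
    set Xp := X.filter (W · = f x) with hXp
    set Yq := Y.filter (W · = g x) with hYq
    have hXpA : Xp ⊆ A := (Finset.filter_subset _ _).trans hXA
    have hRA : R ⊆ A := hRX.trans hXA
    have hAQ : Disjoint A Q := Finset.disjoint_of_subset_right hQY hAY
    have hXY : Disjoint (Xp \ R) Yq :=
      Finset.disjoint_of_subset_left (Finset.sdiff_subset.trans hXpA)
        (Finset.disjoint_of_subset_right (Finset.filter_subset _ _) hAY)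
    have hcardA : (A \ R ∪ Q).card = A.card := by
      rw [Finset.card_union_of_disjoint (Finset.disjoint_of_subset_left Finset.sdiff_subset hAQ),
        Finset.card_sdiff_of_subset hRA, hR, hQ]
      have := Finset.card_le_card hRA
      omega
    have hsub : Xp \ R ⊆ A \ R ∪ Q := fun y hy => by
      rw [Finset.mem_sdiff] at hy
      simp [hXpA hy.1, hy.2]
    have hrank : ((A \ R ∪ Q) \ (Xp \ R)).card <
        finRk M ((A \ R ∪ Q) \ (Xp \ R) ∪ Yq) := by
      have h1 : finRk M (A \ Xp ∪ Yq) ≤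
          finRk M ((A \ R ∪ Q) \ (Xp \ R) ∪ Yq) + (R \ Xp).card := by
        refine (finRk_mono fun y hy => ?_).trans (finRk_union_le_add_card _ _)
        simp only [Finset.mem_union, Finset.mem_sdiff] at hy ⊢
        clear * - hy
        tauto
      have h2 := Finset.card_sdiff_add_card_inter Xp R
      have h3 := Finset.card_sdiff_add_card_inter R Xp
      rw [Finset.inter_comm] at h3
      have h4 := Finset.card_le_card hsub
      have h5 := Finset.card_le_card hXpA
      rw [Finset.card_sdiff_of_subset hsub]
      rw [Finset.card_sdiff_of_subset hXpA] at hl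
      omega
    obtain ⟨a, ha, b, hb, hbA, hbase'⟩ := exists_exchange hbase hXY hrank
    obtain ⟨haX, haR⟩ := Finset.mem_sdiff.mp ha
    obtain ⟨haX, haW⟩ := Finset.mem_filter.mp haX
    obtain ⟨hbY, hbW⟩ := Finset.mem_filter.mp hb
    have hbQ : b ∉ Q := fun h => hbA (Finset.mem_union_right _ h)
    have haQ : a ∉ Q := Finset.disjoint_left.mp hAQ (hXA haX)
    refine ⟨insert a R, Finset.insert_subset haX hRX, insert b Q, Finset.insert_subset hbY hQY,
      ?_, ?_, ?_, ?_⟩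
    · rw [Finset.card_insert_of_notMem haR, Finset.card_insert_of_notMem hx, hR]
    · rw [Finset.card_insert_of_notMem hbQ, Finset.card_insert_of_notMem hx, hQ]
    · convert hbase' using 2
      ext y
      have : y ∈ Q → y ≠ a := fun h h' => haQ (h' ▸ h)
      simp only [Finset.mem_union, Finset.mem_sdiff, Finset.mem_insert, Finset.mem_erase]
      clear * - this
      tauto
    · rw [Finset.sum_insert haR, Finset.sum_insert hbQ, Finset.sum_insert hx, ← hsum, haW, hbW]
      abel

/-! ### Matching linked blocks -/

lemma finRk_union_biUnion_le {κ : Type*} [DecidableEq κ] (Z : Finset α) (T : κ → Finset α) (n : ℕ)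
    (J : Finset κ) (h : ∀ j ∈ J, finRk M (Z ∪ T j) ≤ finRk M Z + n) :
    finRk M (Z ∪ J.biUnion T) ≤ finRk M Z + J.card * n := by
  induction J using Finset.induction_on with
  | empty => simp
  | insert j J hj ih =>
    have h1 := ih fun i hi => h i (Finset.mem_insert_of_mem hi)
    have h2 := h j (Finset.mem_insert_self _ _)
    have h3 := finRk_inter_add_finRk_union_le (M := M) (Z ∪ J.biUnion T) (Z ∪ T j)
    have h4 : finRk M Z ≤ finRk M ((Z ∪ J.biUnion T) ∩ (Z ∪ T j)) :=
      finRk_mono (Finset.subset_inter Finset.subset_union_left Finset.subset_union_left)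
    have h5 : Z ∪ (insert j J).biUnion T = (Z ∪ J.biUnion T) ∪ (Z ∪ T j) := by
      rw [Finset.biUnion_insert, Finset.union_union_union_comm, Finset.union_self,
        Finset.union_comm (T j)]
    rw [h5, Finset.card_insert_of_notMem hj, add_mul, one_mul]
    omega

/-- The rank of `S` after contracting the part of a basis `A` outside several blocks is at most the
sum of its ranks after contracting the part of `A` outside each single block. -/
lemma finRk_sdiff_biUnion_union_le {κ : Type*} [DecidableEq κ] {A : Finset α}
    (hA : M.IsBase (A : Set α)) (S : Finset α) (T : κ → Finset α) (n : ℕ) (I : Finset κ)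
    (h : ∀ i ∈ I, finRk M (A \ T i ∪ S) ≤ (A \ T i).card + n) :
    finRk M (A \ I.biUnion T ∪ S) ≤ (A \ I.biUnion T).card + I.card * n := by
  induction I using Finset.induction_on with
  | empty => simpa using finRk_le_card_of_isBase hA _
  | insert i I hi ih =>
    have h1 := ih fun j hj => h j (Finset.mem_insert_of_mem hj)
    have h2 := h i (Finset.mem_insert_self _ _)
    have h3 := finRk_inter_add_finRk_union_le (M := M) (A \ I.biUnion T ∪ S) (A \ T i ∪ S)
    have h4 : (A \ I.biUnion T ∪ A \ T i).card ≤
        finRk M ((A \ I.biUnion T ∪ S) ∪ (A \ T i ∪ S)) := by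
      rw [← finRk_of_indep (M := M)]
      · exact finRk_mono (Finset.union_subset_union Finset.subset_union_left
          Finset.subset_union_left)
      · refine hA.indep.subset ?_
        exact_mod_cast Finset.union_subset Finset.sdiff_subset Finset.sdiff_subset
    have h5 : A \ (insert i I).biUnion T = (A \ I.biUnion T) ∩ (A \ T i) := by
      rw [Finset.biUnion_insert, Finset.sdiff_union_distrib, Finset.inter_comm]
    have h6 := Finset.card_union_add_card_inter (A \ I.biUnion T) (A \ T i)
    rw [h5, Finset.card_insert_of_notMem hi, add_mul, one_mul, Finset.inter_union_distrib_right]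
    omega

/-- The deficiency version of Hall's theorem, for sets of equal size: the matching is completed
to a bijection with at most `d` violations. -/
lemma exists_equiv_few_exceptions {X Y : Finset α} (hcard : Y.card = X.card) (r : α → α → Prop)
    [∀ b a, Decidable (r b a)] (d : ℕ)
    (h : ∀ S ⊆ Y, S.card ≤ (X.filter fun a => ∃ b ∈ S, r b a).card + d) :
    ∃ σ : Y ≃ X, (Finset.univ.filter fun b : Y => ¬ r b (σ b)).card ≤ d := by
  -- every element of `Y` may also be matched with one of `d` dummies
  let t : Y → Finset (α ⊕ Fin d) := fun b => (X.filter (r b)).disjSum Finset.univ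
  have hHall : ∀ S : Finset Y, S.card ≤ (S.biUnion t).card := by
    intro S
    rcases S.eq_empty_or_nonempty with rfl | hne
    · simp
    have hbi : S.biUnion t =
        (X.filter fun a => ∃ b ∈ S.map (Function.Embedding.subtype _), r b a).disjSum
          Finset.univ := by
      ext y
      rcases y with y | y
      · simp [t]
        tauto
      · obtain ⟨b, hb⟩ := hne
        simpa [t] using ⟨b, b.2, hb⟩
    rw [hbi, Finset.card_disjSum, Finset.card_univ, Fintype.card_fin,
      ← Finset.card_map (Function.Embedding.subtype _)]
    refine h _ fun y hy => ?_
    simp only [Finset.mem_map, Function.Embedding.subtype_apply] at hy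
    obtain ⟨b, -, rfl⟩ := hy
    exact b.2
  obtain ⟨f, hf, hft⟩ := (Finset.all_card_le_biUnion_card_iff_exists_injective t).mp hHall
  set G : Finset Y := Finset.univ.filter fun b => (f b).isLeft with hG
  let g : Y → α := fun b => (f b).elim id fun _ => b
  have hfg : ∀ b ∈ G, f b = Sum.inl (g b) := by
    intro b hb
    obtain ⟨a, ha⟩ := Sum.isLeft_iff.mp (Finset.mem_filter.mp hb).2
    simp [g, ha]
  have hg : ∀ b ∈ G, g b ∈ X ∧ r b (g b) := by
    intro b hb
    have := hft b
    rw [hfg b hb] at this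
    simpa [t] using this
  obtain ⟨σ, hσ⟩ := Finset.exists_equiv_extend_of_card_eq (α := Y) (t := X) (s := G) (f := g)
    (by rw [Fintype.card_coe, hcard])
    (fun a ha => by
      obtain ⟨b, hb, rfl⟩ := Finset.mem_image.mp ha
      exact (hg b hb).1)
    (fun b hb b' hb' hbb' => hf (by rw [hfg b hb, hfg b' hb', hbb']))
  refine ⟨σ, ?_⟩
  have hright : ∀ b ∈ Finset.univ.filter (fun b : Y => ¬ r b (σ b)),
      f b ∈ (Finset.univ : Finset (Fin d)).map Function.Embedding.inr := by
    intro b hb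
    rcases hfb : f b with a | k
    · have hbG : b ∈ G := by simp [hG, hfb]
      exact absurd ((hσ b hbG).symm ▸ (hg b hbG).2) (Finset.mem_filter.mp hb).2
    · simp
  calc _ ≤ ((Finset.univ : Finset (Fin d)).map Function.Embedding.inr).card :=
        Finset.card_le_card_of_injOn f hright hf.injOn
    _ = d := by simp

open Classical in
/-- Most elements of `Y` can be matched with elements of `X` in linked blocks. By the deficiency
version of Hall's theorem, it is enough to bound the rank of a union of blocks of `Y` after
contracting the part of `A` outside the blocks of `X` that are linked to none of them; by
subadditivity it is at most `C - 1` per pair of blocks. -/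
lemma exists_equiv_linked {A X Y : Finset α} {W : α → V} {C τ : ℕ} (hC : 0 < C)
    (hA : M.IsBase (A : Set α)) (hAY : Disjoint A Y)
    (hB : M.Indep ((A \ X ∪ Y : Finset α) : Set α)) (hcard : Y.card = X.card)
    (hτX : (X.image W).card ≤ τ) (hτY : (Y.image W).card ≤ τ) :
    ∃ σ : Y ≃ X, (Finset.univ.filter fun b : Y =>
      ¬ Linked M A X Y W C (W (σ b)) (W b)).card ≤ τ * (τ * (C - 1)) := by
  refine exists_equiv_few_exceptions hcard (fun b a => Linked M A X Y W C (W a) (W b)) _ ?_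
  intro S hS
  set N := X.filter fun a => ∃ b ∈ S, Linked M A X Y W C (W a) (W b) with hN
  set I := (X \ N).image W with hI
  set J := S.image W with hJ
  set Z := A \ I.biUnion fun p => X.filter (W · = p) with hZ
  have hZind : finRk M Z = Z.card :=
    finRk_of_indep (hA.indep.subset (by exact_mod_cast Finset.sdiff_subset))
  have h1 : ∀ q ∈ J, finRk M (Z ∪ Y.filter (W · = q)) ≤ finRk M Z + τ * (C - 1) := by
    intro q hq
    obtain ⟨b, hb, rfl⟩ := Finset.mem_image.mp hq
    rw [hZind]
    refine (finRk_sdiff_biUnion_union_le hA _ _ (C - 1) I fun p hp => ?_).trans ?_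
    · obtain ⟨a, ha, rfl⟩ := Finset.mem_image.mp hp
      obtain ⟨haX, haN⟩ := Finset.mem_sdiff.mp ha
      have : ¬ Linked M A X Y W C (W a) (W b) := fun hl =>
        haN (Finset.mem_filter.mpr ⟨haX, b, hb, hl⟩)
      unfold Linked at this
      omega
    · have : I.card ≤ τ :=
        (Finset.card_le_card (Finset.image_subset_image Finset.sdiff_subset)).trans hτX
      gcongr
  have h2 := finRk_union_biUnion_le Z (fun q => Y.filter (W · = q)) _ J h1
  have hJτ : J.card * (τ * (C - 1)) ≤ τ * (τ * (C - 1)) :=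
    Nat.mul_le_mul_right _ ((Finset.card_le_card (Finset.image_subset_image hS)).trans hτY)
  have h3 : S.card + (A \ X).card ≤ finRk M (Z ∪ J.biUnion fun q => Y.filter (W · = q)) := by
    rw [← Finset.card_union_of_disjoint (Finset.disjoint_of_subset_left hS
      (Finset.disjoint_of_subset_right Finset.sdiff_subset hAY.symm)), ← finRk_of_indep (M := M)]
    · refine finRk_mono (Finset.union_subset (fun b hb => ?_) fun a ha => ?_)
      · refine Finset.mem_union_right _ (Finset.mem_biUnion.mpr
          ⟨W b, Finset.mem_image_of_mem _ hb, ?_⟩)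
        simp [hS hb]
      · obtain ⟨haA, haX⟩ := Finset.mem_sdiff.mp ha
        refine Finset.mem_union_left _ (Finset.mem_sdiff.mpr ⟨haA, fun h => ?_⟩)
        obtain ⟨p, -, hp⟩ := Finset.mem_biUnion.mp h
        exact haX (Finset.mem_filter.mp hp).1
    · refine hB.subset ?_
      rw [Finset.union_comm]
      exact_mod_cast Finset.union_subset_union_right hS
  have h4 : Z.card ≤ (A \ X).card + N.card := by
    refine (Finset.card_le_card fun a ha => ?_).trans (Finset.card_union_le _ _)
    obtain ⟨haA, haI⟩ := Finset.mem_sdiff.mp ha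
    by_cases haX : a ∈ X
    · refine Finset.mem_union_right _ ?_
      by_contra haN
      refine haI (Finset.mem_biUnion.mpr ⟨W a, Finset.mem_image_of_mem _
        (Finset.mem_sdiff.mpr ⟨haX, haN⟩), ?_⟩)
      simp [haX]
    · exact Finset.mem_union_left _ (Finset.mem_sdiff.mpr ⟨haA, haX⟩)
  omega

end Exchange

/-! ### Proximity of bases -/

lemma card_image_le_of_bounded {α : Type*} {m Δ : ℕ} {W : α → Fin m → ℤ} {S : Finset α}
    (hW : ∀ e ∈ S, ∀ i, -(Δ : ℤ) ≤ W e i ∧ W e i ≤ (Δ : ℤ)) :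
    (S.image W).card ≤ (2 * Δ + 1) ^ m := by
  have hsub : S.image W ⊆ Fintype.piFinset fun _ => Finset.Icc (-(Δ : ℤ)) Δ := by
    intro w hw
    obtain ⟨e, he, rfl⟩ := Finset.mem_image.mp hw
    simpa using hW e he
  refine (Finset.card_le_card hsub).trans_eq ?_
  rw [Fintype.card_piFinset]
  simp only [Int.card_Icc, Finset.prod_const, Finset.card_univ, Fintype.card_fin]
  rw [show (Δ : ℤ) + 1 - -(Δ : ℤ) = ((2 * Δ + 1 : ℕ) : ℤ) by push_cast; ring, Int.toNat_natCast]

/-- If the bases `A` and `B` are far apart, then a basis of the same weight as `A` is closer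
to `B`. -/
lemma exists_closer_basis {α : Type*} [DecidableEq α] {M : Matroid α} {m Δ : ℕ} (hΔ : 0 < Δ)
    {W : α → Fin m → ℤ} (hW : ∀ e ∈ M.E, ∀ i, -(Δ : ℤ) ≤ W e i ∧ W e i ≤ (Δ : ℤ))
    {A B : Finset α} (hA : M.IsBase (A : Set α)) (hB : M.IsBase (B : Set α)) {C τ L : ℕ}
    (hC : C = (2 * (m * (2 * Δ)) + 1) ^ m) (hτ : τ = (2 * Δ + 1) ^ m)
    (hL : L = ∑ i, ((setWeight W B - setWeight W A) i).natAbs)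
    (hfar : C * (τ * (τ * (C - 1)) + L) < (A \ B).card + L) :
    ∃ A' : Finset α, M.IsBase (A' : Set α) ∧ setWeight W A' = setWeight W A ∧
      (A' \ B).card < (A \ B).card := by
  classical
  set X := A \ B with hX
  set Y := B \ A with hY
  set δ := setWeight W B - setWeight W A with hδ
  have hAX : A \ X = A ∩ B := by simp [hX]
  have hXA : X ⊆ A := Finset.sdiff_subset
  have hAY : Disjoint A Y := Finset.disjoint_sdiff
  have hcardAB : A.card = B.card := by
    have := hA.encard_eq_encard_of_isBase hB
    simp only [Set.encard_coe_eq_coe_finsetCard] at this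
    exact_mod_cast this
  have hcard : Y.card = X.card := (Finset.card_sdiff_comm hcardAB).symm
  have hWX : ∀ e ∈ X, ∀ i, -(Δ : ℤ) ≤ W e i ∧ W e i ≤ (Δ : ℤ) := fun e he =>
    hW e (hA.subset_ground (hXA he))
  have hWY : ∀ e ∈ Y, ∀ i, -(Δ : ℤ) ≤ W e i ∧ W e i ≤ (Δ : ℤ) := fun e he =>
    hW e (hB.subset_ground (Finset.sdiff_subset he))
  have hind : M.Indep ((A \ X ∪ Y : Finset α) : Set α) := by
    refine hB.indep.subset ?_
    rw [hAX]
    exact_mod_cast Finset.union_subset Finset.inter_subset_right Finset.sdiff_subset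
  obtain ⟨σ, hσ⟩ := exists_equiv_linked (C := C) (τ := τ) (W := W) (by rw [hC]; positivity) hA hAY
    hind hcard (hτ ▸ card_image_le_of_bounded hWX) (hτ ▸ card_image_le_of_bounded hWY)
  set exc := Finset.univ.filter fun b : Y => ¬ Linked M A X Y W C (W (σ b)) (W b) with hexc
  -- exchange vectors, completed by unit vectors to a zero-sum family
  let v : Y ⊕ ((i : Fin m) × Fin (δ i).natAbs) → Fin m → ℤ :=
    Sum.elim (fun b => W b - W (σ b)) fun k => Pi.single k.1 (-(δ k.1).sign)
  have hv : ∀ x ∈ Finset.univ, ∀ i, |v x i| ≤ ((2 * Δ : ℕ) : ℤ) := by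
    rintro (b | ⟨j, k⟩) - i
    · have h1 := hWY b b.2 i
      have h2 := hWX (σ b) (σ b).2 i
      simp only [v, Sum.elim_inl, Pi.sub_apply]
      rw [abs_le]
      push_cast
      constructor <;> linarith
    · simp only [v, Sum.elim_inr]
      have hs : |(δ j).sign| ≤ 1 := by
        rcases Int.sign_trichotomy (δ j) with h | h | h <;> simp [h]
      rcases eq_or_ne i j with rfl | hij
      · rw [Pi.single_eq_same, abs_neg]
        omega
      · rw [Pi.single_eq_of_ne hij, abs_zero]
        positivity
  have hsum : ∑ x, v x = 0 := by
    have h1 : ∑ b : Y, (W b - W (σ b)) = δ := by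
      rw [Finset.sum_sub_distrib, Equiv.sum_comp σ fun a : X => W a, Finset.sum_coe_sort Y W,
        Finset.sum_coe_sort X W, hδ, hX, hY]
      exact Finset.sum_sdiff_sub_sum_sdiff
    have h2 : ∑ k : (i : Fin m) × Fin (δ i).natAbs,
        (Pi.single k.1 (-(δ k.1).sign) : Fin m → ℤ) = -δ := by
      rw [Fintype.sum_sigma]
      simp only [Finset.sum_const, Finset.card_univ, Fintype.card_fin]
      ext i
      rw [Finset.sum_apply, Finset.sum_eq_single i]
      · simp only [Pi.smul_apply, Pi.single_eq_same, Pi.neg_apply, nsmul_eq_mul, mul_neg]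
        rw [mul_comm, Int.sign_mul_natAbs]
      · intro j _ hj
        simp [Pi.single_eq_of_ne hj.symm]
      · simp
    rw [Fintype.sum_sum_type]
    simp only [v, Sum.elim_inl, Sum.elim_inr]
    rw [h1, h2, add_neg_cancel]
  have hcardL : Fintype.card ((i : Fin m) × Fin (δ i).natAbs) = L := by
    simp [hL]
  obtain ⟨J, -, hJE, hJne, hJC, hJ0⟩ := exists_small_zero_sum_avoiding v (2 * Δ) Finset.univ
    (exc.disjSum Finset.univ) hv hsum (by
      rw [Finset.univ_inter, Finset.card_disjSum, Finset.card_univ, Finset.card_univ, hcardL,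
        Fintype.card_sum, hcardL, Fintype.card_coe, hcard, ← hC]
      exact (Nat.mul_le_mul_left _ (Nat.add_le_add_right hσ _)).trans_lt hfar)
  have hJinl : ∀ x ∈ J, ∃ b : Y, x = Sum.inl b ∧ Linked M A X Y W C (W (σ b)) (W b) := by
    rintro (b | k) hx
    · refine ⟨b, rfl, ?_⟩
      by_contra hb
      exact Finset.disjoint_left.mp hJE hx (by simp [hexc, hb])
    · exact absurd (by simp) (Finset.disjoint_left.mp hJE hx)
  obtain ⟨R, hRX, Q, hQY, hR, hQ, hbase, hsumRQ⟩ := exists_simultaneous_exchange (W := W) (C := C)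
    hA hXA hAY J (Sum.elim (fun b => W (σ b)) 0) (Sum.elim (fun b => W b) 0) (hC ▸ hJC) (by
      intro x hx
      obtain ⟨b, rfl, hb⟩ := hJinl x hx
      exact hb)
  have hRQ : ∑ b ∈ Q, W b - ∑ a ∈ R, W a = 0 := by
    rw [hsumRQ, ← hJ0]
    refine Finset.sum_congr rfl fun x hx => ?_
    obtain ⟨b, rfl, -⟩ := hJinl x hx
    rfl
  refine ⟨A \ R ∪ Q, hbase, ?_, ?_⟩
  · have hdisj : Disjoint (A \ R) Q :=
      Finset.disjoint_of_subset_left Finset.sdiff_subset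
        (Finset.disjoint_of_subset_right hQY hAY)
    unfold setWeight
    rw [Finset.sum_union hdisj, sub_eq_zero.mp hRQ, Finset.sum_sdiff (hRX.trans hXA)]
  · have hsub : (A \ R ∪ Q) \ B ⊆ X \ R := by
      intro e he
      have hQB : e ∈ Q → e ∈ B := fun h => Finset.sdiff_subset (hQY h)
      simp only [hX, Finset.mem_sdiff, Finset.mem_union] at he ⊢
      tauto
    have hRpos : 0 < R.card := hR ▸ Finset.card_pos.mpr hJne
    refine (Finset.card_le_card hsub).trans_lt ?_
    rw [Finset.card_sdiff_of_subset hRX]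
    have := Finset.card_le_card hRX
    omega

lemma four_mul_sq_mul_sq_le {m Δ : ℕ} (hm : 0 < m) (hΔ : 0 < Δ) :
    4 * (((2 * (m * (2 * Δ)) + 1) ^ m) ^ 2 * ((2 * Δ + 1) ^ m) ^ 2) ≤
      (2 * m * Δ) ^ (12 * m) := by
  set β := 2 * m * Δ with hβ
  have hΔβ : 2 * Δ ≤ β := by rw [hβ, mul_right_comm]; exact Nat.le_mul_of_pos_right _ hm
  have h2 : 2 ≤ β := by omega
  have h1 : (2 * (m * (2 * Δ)) + 1) ^ 2 ≤ β ^ 5 := by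
    rw [show 2 * (m * (2 * Δ)) + 1 = 2 * β + 1 by rw [hβ]; ring]
    have : 8 ≤ β ^ 3 := by simpa using Nat.pow_le_pow_left h2 3
    calc (2 * β + 1) ^ 2 ≤ 8 * β ^ 2 := by nlinarith
      _ ≤ β ^ 3 * β ^ 2 := Nat.mul_le_mul_right _ this
      _ = β ^ 5 := by ring
  have h3 : (2 * Δ + 1) ^ 2 ≤ β ^ 4 := by
    have : 2 * Δ + 1 ≤ β ^ 2 := by nlinarith
    calc (2 * Δ + 1) ^ 2 ≤ (β ^ 2) ^ 2 := Nat.pow_le_pow_left this 2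
      _ = β ^ 4 := by ring
  have h4 : 4 ≤ β ^ (3 * m) :=
    calc 4 ≤ 2 ^ 3 := by norm_num
      _ ≤ β ^ 3 := Nat.pow_le_pow_left h2 3
      _ ≤ β ^ (3 * m) := Nat.pow_le_pow_right (by omega) (by omega)
  calc _ = 4 * (((2 * (m * (2 * Δ)) + 1) ^ 2) ^ m * ((2 * Δ + 1) ^ 2) ^ m) := by
        rw [← pow_mul, ← pow_mul, ← pow_mul, ← pow_mul, mul_comm m 2]
    _ ≤ β ^ (3 * m) * ((β ^ 5) ^ m * (β ^ 4) ^ m) := by gcongr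
    _ = β ^ (12 * m) := by
        rw [← pow_mul, ← pow_mul, ← pow_add, ← pow_add]
        congr 1
        ring

theorem theorem1 {α : Type*} [DecidableEq α] (M : Matroid α) [M.Finite] (m Δ : ℕ)
    (W : α → Fin m → ℤ) (hW : ∀ e ∈ M.E, ∀ i, -(Δ : ℤ) ≤ W e i ∧ W e i ≤ (Δ : ℤ))
    (A B : Finset α) (hA : M.IsBase (A : Set α)) (hB : M.IsBase (B : Set α)) :
    ∃ A' : Finset α, M.IsBase (A' : Set α) ∧ setWeight W A' = setWeight W A ∧
      ((symmDiff A' B).card : ℤ) ≤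
        (2 * (m : ℤ) * (Δ : ℤ)) ^ (12 * m) * l1Norm (setWeight W B - setWeight W A) := by
  by_cases hAB : setWeight W B = setWeight W A
  · exact ⟨B, hB, hAB, by simp [hAB, l1Norm]⟩
  -- different weights force `m` and `Δ` to be positive
  obtain ⟨i, hi⟩ := Function.ne_iff.mp hAB
  have hm : 0 < m := i.pos
  have hΔ : 0 < Δ := by
    rw [Nat.pos_iff_ne_zero]
    rintro rfl
    have hzero : ∀ S : Finset α, (S : Set α) ⊆ M.E → setWeight W S i = 0 := by
      intro S hS
      rw [setWeight, Finset.sum_apply]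
      refine Finset.sum_eq_zero fun e he => ?_
      have := hW e (hS he) i
      simp only [Nat.cast_zero, neg_zero] at this
      exact le_antisymm this.2 this.1
    exact hi (by rw [hzero B hB.subset_ground, hzero A hA.subset_ground])
  induction hn : (A \ B).card using Nat.strong_induction_on generalizing A with
  | _ n ih =>
  subst hn
  set C := (2 * (m * (2 * Δ)) + 1) ^ m with hC
  set τ := (2 * Δ + 1) ^ m with hτ
  set L := ∑ j, ((setWeight W B - setWeight W A) j).natAbs with hL
  by_cases hfar : C * (τ * (τ * (C - 1)) + L) < (A \ B).card + L
  · obtain ⟨A₁, hA₁, hw, hlt⟩ := exists_closer_basis hΔ hW hA hB hC hτ hL hfar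
    obtain ⟨A', hA', hw', hle⟩ := ih _ hlt A₁ hA₁ (hw ▸ hAB) (hw ▸ hi) rfl
    exact ⟨A', hA', hw'.trans hw, hw ▸ hle⟩
  refine ⟨A, hA, rfl, ?_⟩
  push Not at hfar
  have hcardAB : A.card = B.card := by
    have := hA.encard_eq_encard_of_isBase hB
    simp only [Set.encard_coe_eq_coe_finsetCard] at this
    exact_mod_cast this
  have hsymm : (symmDiff A B).card = 2 * (A \ B).card := by
    rw [symmDiff_def, Finset.sup_eq_union,
      Finset.card_union_of_disjoint disjoint_sdiff_sdiff, Finset.card_sdiff_comm hcardAB.symm]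
    ring
  have hl1 : l1Norm (setWeight W B - setWeight W A) = L := by
    simp [l1Norm, hL]
  have hLpos : 1 ≤ L := by
    have h1 : 1 ≤ ((setWeight W B - setWeight W A) i).natAbs :=
      Int.natAbs_pos.mpr (sub_ne_zero.mpr hi)
    exact h1.trans (Finset.single_le_sum
      (f := fun j => ((setWeight W B - setWeight W A) j).natAbs) (fun _ _ => Nat.zero_le _)
      (Finset.mem_univ i))
  have hCpos : 1 ≤ C := Nat.one_le_pow _ _ (by omega)
  have hτpos : 1 ≤ τ := Nat.one_le_pow _ _ (by omega)
  have hnat : 2 * (A \ B).card ≤ (2 * m * Δ) ^ (12 * m) * L := by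
    calc 2 * (A \ B).card ≤ 2 * (C * (τ * (τ * (C - 1)) + L)) := by omega
      _ ≤ 2 * (C * (τ * (τ * C) * L + C * (τ * τ) * L)) := by
          refine Nat.mul_le_mul_left _ (Nat.mul_le_mul_left _ (Nat.add_le_add ?_ ?_))
          · calc τ * (τ * (C - 1)) ≤ τ * (τ * C) := by gcongr; omega
              _ ≤ τ * (τ * C) * L := Nat.le_mul_of_pos_right _ hLpos
          · exact Nat.le_mul_of_pos_left _ (by positivity)
      _ = 4 * (C ^ 2 * τ ^ 2) * L := by ring
      _ ≤ (2 * m * Δ) ^ (12 * m) * L :=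
          Nat.mul_le_mul_right _ (four_mul_sq_mul_sq_le hm hΔ)
  rw [hsymm, hl1]
  exact_mod_cast hnat
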